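/- An $n\times n$ complex matrix $T$ is Toeplitz if $T_{i,j}=T_{i+1,j+1}$ for all $1\le i,j\le n-1$. For $M\in\mathbb{C}^{n\times n}$ let $\mathrm{Toep}(M)$ be the least $s\ge 1$ such that $M=T_1T_2\cdots T_s$ for some Toeplitz matrices $T_1,\dots,T_s\in\mathbb{C}^{n\times n}$ ($\infty$ if there is no such $s$), and let $\mathrm{Toep}_n$ be the maximum of $\mathrm{Toep}(M)$ over all $M\in\mathbb{C}^{n\times n}$. Then \[3\le \mathrm{Toep}_3\le 4 .\] Moreover, $\mathrm{Toep}(\operatorname{diag}(1,2,3))=3$, and for every $M\in\mathbb{C}^{3\times 3}$: if $\operatorname{rank} M=1$ then $\mathrm{Toep}(M)\le 3$; if $\operatorname{rank} M=2$ then $\mathrm{Toep}(M)\le 4$; if $M$ is invertible then $\mathrm{Toep}(M)\le 4$. -/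

import Mathlib

/-- A square matrix is Toeplitz if it is constant along each diagonal:
`M i j = M (i+1) (j+1)` whenever all four indices are in range. -/
def IsToeplitz {n : ℕ} (M : Matrix (Fin n) (Fin n) ℂ) : Prop :=
  ∀ i j i' j' : Fin n, i'.val = i.val + 1 → j'.val = j.val + 1 → M i j = M i' j'

/-- `M` has a Toeplitz decomposition `M = T₁ ⋯ Tₛ` of length `s`. -/
def HasToeplitzDecomposition {n : ℕ} (M : Matrix (Fin n) (Fin n) ℂ) (s : ℕ) : Prop :=
  ∃ T : Fin s → Matrix (Fin n) (Fin n) ℂ,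
    (∀ k, IsToeplitz (T k)) ∧ M = (List.ofFn T).prod

/-- The Toeplitz number of `M`: the minimal length `s ≥ 1` of a Toeplitz decomposition of `M`
(it is `⊤` if there is none). -/
noncomputable def toeplitzNumber {n : ℕ} (M : Matrix (Fin n) (Fin n) ℂ) : ℕ∞ :=
  ⨅ (s : ℕ) (_ : 1 ≤ s ∧ HasToeplitzDecomposition M s), (s : ℕ∞)

/-- The maximal Toeplitz number of order `n`: the maximum of `toeplitzNumber M` over all
complex `n × n` matrices. In `ℕ∞` a finite supremum of a nonempty family is attained,
so whenever this value is finite it is a maximum. -/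
noncomputable def maxToeplitzNumber (n : ℕ) : ℕ∞ :=
  ⨆ M : Matrix (Fin n) (Fin n) ℂ, toeplitzNumber M

/-! Upper bound: every `N` with `N 0 2 ≠ 0` on a certain cubic hypersurface is a product `L₁ T L₂`
with `T` Toeplitz and `L₁`, `L₂` lower unitriangular Toeplitz
(`isLowerSandwich_of_sandwichForm_eq_zero`). Given `M`, one usually seeks a Toeplitz `X` with
Toeplitz inverse, upper unitriangular or `f`-circulant, such that `M X` lies on it; `X⁻¹` is then
the fourth factor. Elimination by triangular Toeplitz matrices, transposition and reversal of the
indices leave few normal forms, where the condition is a polynomial equation solvable over `ℂ`. A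
rank one matrix needs only three factors, the middle one all ones.

Lower bound: reversing the indices of a Toeplitz matrix transposes it, so `S T = diag(1,2,3)` forces
`T S = diag(3,2,1)`; then `S` intertwines the two diagonals, and its middle row vanishes
(`diagonal_ne_mul`). -/

/-- The `3 × 3` Toeplitz matrix with diagonals `a, b, c, d, e`, from the upper right corner
to the lower left one. -/
def toep (a b c d e : ℂ) : Matrix (Fin 3) (Fin 3) ℂ := !![c, b, a; d, c, b; e, d, c]

/-- Lower unitriangular Toeplitz matrices. -/
def lowerToep (p q : ℂ) : Matrix (Fin 3) (Fin 3) ℂ := !![1, 0, 0; p, 1, 0; q, p, 1]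

/-- Upper unitriangular Toeplitz matrices. -/
def upperToep (u v : ℂ) : Matrix (Fin 3) (Fin 3) ℂ := !![1, u, v; 0, 1, u; 0, 0, 1]

/-- The element `x + y Z + z Z²` of the algebra generated by the `f`-circulant shift `Z`. -/
def circToep (f x y z : ℂ) : Matrix (Fin 3) (Fin 3) ℂ :=
  !![x, f * z, f * y; y, x, f * z; z, y, x]

/-! ### Symmetries and inverses of Toeplitz matrices. -/

theorem isToeplitz_of_entries (a b c d e : ℂ) :
    IsToeplitz !![c, b, a; d, c, b; e, d, c] := by
  intro i j i' j' hi hj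
  fin_cases i <;> fin_cases j <;> fin_cases i' <;> fin_cases j' <;> simp_all

theorem isToeplitz_toep (a b c d e : ℂ) : IsToeplitz (toep a b c d e) :=
  isToeplitz_of_entries a b c d e

theorem isToeplitz_lowerToep (p q : ℂ) : IsToeplitz (lowerToep p q) :=
  isToeplitz_of_entries 0 0 1 p q

theorem isToeplitz_upperToep (u v : ℂ) : IsToeplitz (upperToep u v) :=
  isToeplitz_of_entries v u 1 0 0

theorem isToeplitz_circToep (f x y z : ℂ) : IsToeplitz (circToep f x y z) :=
  isToeplitz_of_entries (f * y) (f * z) x y z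

theorem IsToeplitz.smul {n : ℕ} {T : Matrix (Fin n) (Fin n) ℂ} (hT : IsToeplitz T) (c : ℂ) :
    IsToeplitz (c • T) := by
  intro i j i' j' hi hj
  simp [hT i j i' j' hi hj]

theorem IsToeplitz.transpose {n : ℕ} {T : Matrix (Fin n) (Fin n) ℂ} (hT : IsToeplitz T) :
    IsToeplitz T.transpose :=
  fun i j i' j' hi hj => hT j i j' i' hj hi

theorem IsToeplitz.flip {n : ℕ} {T : Matrix (Fin n) (Fin n) ℂ} (hT : IsToeplitz T) :
    IsToeplitz (T.submatrix Fin.revPerm Fin.revPerm) := by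
  intro i j i' j' hi hj
  refine (hT i'.rev j'.rev i.rev j.rev ?_ ?_).symm <;> simp only [Fin.val_rev] <;> omega

theorem IsToeplitz.eq_toep {T : Matrix (Fin 3) (Fin 3) ℂ} (hT : IsToeplitz T) :
    T = toep (T 0 2) (T 0 1) (T 0 0) (T 1 0) (T 2 0) := by
  have h1 := hT 0 0 1 1 rfl rfl
  have h2 := hT 1 1 2 2 rfl rfl
  have h3 := hT 0 1 1 2 rfl rfl
  have h4 := hT 1 0 2 1 rfl rfl
  ext i j
  fin_cases i <;> fin_cases j <;> simp [toep, h1, h2, h3, h4]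

theorem lowerToep_mul (p q r s : ℂ) :
    lowerToep p q * lowerToep r s = lowerToep (p + r) (q + p * r + s) := by
  ext i j
  fin_cases i <;> fin_cases j <;> simp [lowerToep, Matrix.mul_apply, Fin.sum_univ_three]

theorem upperToep_mul (u v r s : ℂ) :
    upperToep u v * upperToep r s = upperToep (u + r) (v + u * r + s) := by
  ext i j
  fin_cases i <;> fin_cases j <;>
    simp [upperToep, Matrix.mul_apply, Fin.sum_univ_three] <;> ring

theorem lowerToep_zero : lowerToep 0 0 = 1 := by
  ext i j
  fin_cases i <;> fin_cases j <;> simp [lowerToep]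

theorem upperToep_zero : upperToep 0 0 = 1 := by
  ext i j
  fin_cases i <;> fin_cases j <;> simp [upperToep]

theorem lowerToep_inv_mul (p q : ℂ) : lowerToep (-p) (p ^ 2 - q) * lowerToep p q = 1 := by
  rw [lowerToep_mul, ← lowerToep_zero]; congr 1 <;> ring

theorem upperToep_mul_inv (u v : ℂ) : upperToep u v * upperToep (-u) (u ^ 2 - v) = 1 := by
  rw [upperToep_mul, ← upperToep_zero]; congr 1 <;> ring

theorem lowerToep_transpose (p q : ℂ) : (lowerToep p q).transpose = upperToep p q := by
  ext i j
  fin_cases i <;> fin_cases j <;> simp [lowerToep, upperToep]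

/-- Since `Z³ = f`, the `f`-circulants form a commutative algebra containing their adjugates; the
scalar is the norm. -/
theorem circToep_mul_adjugate (f x y z : ℂ) :
    circToep f x y z * circToep f (x ^ 2 - f * y * z) (f * z ^ 2 - x * y) (y ^ 2 - x * z) =
      (x ^ 3 + f * y ^ 3 + f ^ 2 * z ^ 3 - 3 * f * x * y * z) • 1 := by
  ext i j
  fin_cases i <;> fin_cases j <;>
    simp [circToep, Matrix.mul_apply, Fin.sum_univ_three] <;> ring

/-! ### Products of four Toeplitz matrices and the cubic criterion. -/

/-- `M` is a product of four Toeplitz matrices. -/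
def IsFourToeplitz (M : Matrix (Fin 3) (Fin 3) ℂ) : Prop :=
  ∃ A B C D, IsToeplitz A ∧ IsToeplitz B ∧ IsToeplitz C ∧ IsToeplitz D ∧ M = A * B * C * D

theorem IsFourToeplitz.transpose {M : Matrix (Fin 3) (Fin 3) ℂ} (h : IsFourToeplitz M) :
    IsFourToeplitz M.transpose := by
  obtain ⟨A, B, C, D, hA, hB, hC, hD, rfl⟩ := h
  exact ⟨_, _, _, _, hD.transpose, hC.transpose, hB.transpose, hA.transpose, by
    simp only [Matrix.transpose_mul, Matrix.mul_assoc]⟩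

theorem IsFourToeplitz.of_transpose {M : Matrix (Fin 3) (Fin 3) ℂ}
    (h : IsFourToeplitz M.transpose) : IsFourToeplitz M := by
  simpa using h.transpose

theorem IsFourToeplitz.of_flip {M : Matrix (Fin 3) (Fin 3) ℂ}
    (h : IsFourToeplitz (M.submatrix Fin.revPerm Fin.revPerm)) : IsFourToeplitz M := by
  obtain ⟨A, B, C, D, hA, hB, hC, hD, h⟩ := h
  refine ⟨_, _, _, _, hA.flip, hB.flip, hC.flip, hD.flip, ?_⟩
  simp only [Matrix.submatrix_mul_equiv, ← h]
  ext i j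
  simp

/-- `M = L₁ T L₂` with `T` Toeplitz and `L₁`, `L₂` lower unitriangular Toeplitz. -/
def IsLowerSandwich (M : Matrix (Fin 3) (Fin 3) ℂ) : Prop :=
  ∃ p q r s T, IsToeplitz T ∧ M = lowerToep p q * T * lowerToep r s

/-- The cubic form whose vanishing characterizes `IsLowerSandwich` when `N 0 2 ≠ 0`. -/
def sandwichForm (N : Matrix (Fin 3) (Fin 3) ℂ) : ℂ :=
  N 0 2 ^ 2 * (N 1 0 - N 2 1) + N 0 2 * (N 1 2 - N 0 1) * (N 1 1 - N 2 2) +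
    N 1 2 * (N 0 2 * (N 2 2 - N 0 0) - (N 1 2 - N 0 1) * N 0 1)

/-- Make `lowerToep 0 q * N * lowerToep r s` Toeplitz: as `N 0 2 ≠ 0`, three of the four equations
determine `r`, `s`, `q`, and the fourth, `hE`, becomes the cubic form. -/
theorem isLowerSandwich_of_sandwichForm_eq_zero {N : Matrix (Fin 3) (Fin 3) ℂ}
    (h02 : N 0 2 ≠ 0) (hG : sandwichForm N = 0) : IsLowerSandwich N := by
  obtain ⟨r, hr⟩ : ∃ r, r * N 0 2 = N 1 2 - N 0 1 := ⟨_, div_mul_cancel₀ _ h02⟩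
  obtain ⟨s, hs⟩ : ∃ s, s * N 0 2 = N 1 1 + r * N 1 2 - N 0 0 - r * N 0 1 :=
    ⟨_, div_mul_cancel₀ _ h02⟩
  obtain ⟨q, hq⟩ : ∃ q, q * N 0 2 = N 1 1 + r * N 1 2 - N 2 2 := ⟨_, div_mul_cancel₀ _ h02⟩
  have hE : N 1 0 + r * N 1 1 + s * N 1 2 = N 2 1 + r * N 2 2 + q * N 1 2 := by
    have : N 0 2 ^ 2 * (N 1 0 + r * N 1 1 + s * N 1 2 - (N 2 1 + r * N 2 2 + q * N 1 2)) = 0 := by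
      rw [← hG, sandwichForm]
      linear_combination (N 0 2 * (N 1 1 - N 2 2) - N 1 2 * N 0 1) * hr + N 0 2 * N 1 2 * hs -
        N 0 2 * N 1 2 * hq
    exact sub_eq_zero.1 ((mul_eq_zero.1 this).resolve_left (pow_ne_zero 2 h02))
  refine ⟨0, -q, -r, r ^ 2 - s, _, isToeplitz_toep (N 0 2) (N 1 2) (N 1 1 + r * N 1 2)
    (N 1 0 + r * N 1 1 + s * N 1 2)
    (N 2 0 + q * N 0 0 + r * (N 2 1 + q * N 0 1) + s * (N 2 2 + q * N 0 2)), ?_⟩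
  ext i j
  fin_cases i <;> fin_cases j <;>
    simp [lowerToep, toep, Matrix.mul_apply, Fin.sum_univ_three]
  · linear_combination hs - r * hr
  · linear_combination hr
  · ring
  · ring
  · linear_combination r * hE + (r ^ 2 - s) * hq - q * hs
  · linear_combination -hE - r * hq
  · linear_combination hq

theorem IsLowerSandwich.smul {M : Matrix (Fin 3) (Fin 3) ℂ} (h : IsLowerSandwich M) (c : ℂ) :
    IsLowerSandwich (c • M) := by
  obtain ⟨p, q, r, s, T, hT, rfl⟩ := h
  exact ⟨p, q, r, s, _, hT.smul c, by simp⟩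

theorem IsLowerSandwich.lowerToep_mul {M : Matrix (Fin 3) (Fin 3) ℂ} (h : IsLowerSandwich M)
    (p q : ℂ) : IsLowerSandwich (lowerToep p q * M) := by
  obtain ⟨p', q', r, s, T, hT, rfl⟩ := h
  exact ⟨p + p', q + p * p' + q', r, s, T, hT, by
    rw [← _root_.lowerToep_mul]; simp only [Matrix.mul_assoc]⟩

/-- `M = L₁ T L₂ Y` with `T`, `Y` Toeplitz and `L₁`, `L₂` lower unitriangular Toeplitz. -/
def IsSandwichMul (M : Matrix (Fin 3) (Fin 3) ℂ) : Prop :=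
  ∃ N Y, IsLowerSandwich N ∧ IsToeplitz Y ∧ M = N * Y

theorem IsSandwichMul.isFourToeplitz {M : Matrix (Fin 3) (Fin 3) ℂ} (h : IsSandwichMul M) :
    IsFourToeplitz M := by
  obtain ⟨N, Y, ⟨p, q, r, s, T, hT, rfl⟩, hY, rfl⟩ := h
  exact ⟨_, _, _, _, isToeplitz_lowerToep p q, hT, isToeplitz_lowerToep r s, hY, rfl⟩

theorem IsSandwichMul.of_lowerToep_mul {M : Matrix (Fin 3) (Fin 3) ℂ} {p q c : ℂ} (hc : c ≠ 0)
    (h : IsSandwichMul (c • (lowerToep p q * M))) : IsSandwichMul M := by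
  obtain ⟨N, Y, hN, hY, h⟩ := h
  refine ⟨_, Y, (hN.lowerToep_mul (-p) (p ^ 2 - q)).smul c⁻¹, hY, ?_⟩
  rw [Matrix.smul_mul, Matrix.mul_assoc, ← h, Matrix.mul_smul, ← Matrix.mul_assoc,
    lowerToep_inv_mul, smul_smul, inv_mul_cancel₀ hc, one_smul, one_mul]

theorem IsLowerSandwich.isSandwichMul {M : Matrix (Fin 3) (Fin 3) ℂ} (h : IsLowerSandwich M) :
    IsSandwichMul M :=
  ⟨M, 1, h, upperToep_zero ▸ isToeplitz_upperToep 0 0, (mul_one M).symm⟩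

theorem isSandwichMul_of_mul_circToep {M : Matrix (Fin 3) (Fin 3) ℂ} {f x y z : ℂ}
    (hdet : x ^ 3 + f * y ^ 3 + f ^ 2 * z ^ 3 - 3 * f * x * y * z ≠ 0)
    (h : IsLowerSandwich (M * circToep f x y z)) : IsSandwichMul M := by
  refine ⟨_, _, h, (isToeplitz_circToep f (x ^ 2 - f * y * z) (f * z ^ 2 - x * y)
    (y ^ 2 - x * z)).smul (x ^ 3 + f * y ^ 3 + f ^ 2 * z ^ 3 - 3 * f * x * y * z)⁻¹, ?_⟩
  rw [Matrix.mul_smul, Matrix.mul_assoc, circToep_mul_adjugate, Matrix.mul_smul, smul_smul,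
    inv_mul_cancel₀ hdet, one_smul, mul_one]

/-- `M = L₁ T L₂ U` with `U` upper unitriangular Toeplitz. -/
def IsSandwichUpper (M : Matrix (Fin 3) (Fin 3) ℂ) : Prop :=
  ∃ u v, IsLowerSandwich (M * upperToep u v)

theorem IsSandwichUpper.isSandwichMul {M : Matrix (Fin 3) (Fin 3) ℂ} (h : IsSandwichUpper M) :
    IsSandwichMul M := by
  obtain ⟨u, v, h⟩ := h
  exact ⟨_, _, h, isToeplitz_upperToep (-u) (u ^ 2 - v), by
    rw [Matrix.mul_assoc, upperToep_mul_inv, mul_one]⟩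

theorem IsSandwichUpper.isFourToeplitz_of_equiv {M : Matrix (Fin 3) (Fin 3) ℂ} {c p q u v : ℂ}
    (hc : c ≠ 0) (h : IsSandwichUpper (c • (lowerToep p q * M * upperToep u v))) :
    IsFourToeplitz M := by
  obtain ⟨u', v', h⟩ := h
  have h' : IsSandwichUpper (c • (lowerToep p q * M)) := by
    refine ⟨u + u', v + u * u' + v', ?_⟩
    rw [← upperToep_mul]
    simpa only [Matrix.smul_mul, Matrix.mul_assoc] using h
  exact (IsSandwichMul.of_lowerToep_mul hc h'.isSandwichMul).isFourToeplitz

/-! ### Roots and non-roots of complex polynomials. -/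

theorem exists_poly_ne_zero {c₀ c₁ c₂ c₃ c₄ c₅ c₆ : ℂ}
    (h : c₀ ≠ 0 ∨ c₁ ≠ 0 ∨ c₂ ≠ 0 ∨ c₃ ≠ 0 ∨ c₄ ≠ 0 ∨ c₅ ≠ 0 ∨ c₆ ≠ 0) (F : Finset ℂ) :
    ∃ x ∉ F, c₀ + c₁ * x + c₂ * x ^ 2 + c₃ * x ^ 3 + c₄ * x ^ 4 + c₅ * x ^ 5 + c₆ * x ^ 6 ≠ 0 := by
  open Polynomial in
  let P : ℂ[X] := C c₀ + C c₁ * X + C c₂ * X ^ 2 + C c₃ * X ^ 3 + C c₄ * X ^ 4 + C c₅ * X ^ 5 +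
    C c₆ * X ^ 6
  have hP : P ≠ 0 := by
    intro h0
    have hc : ∀ n, P.coeff n = 0 := fun n => by rw [h0, Polynomial.coeff_zero]
    have h0 := hc 0
    have h1 := hc 1
    have h2 := hc 2
    have h3 := hc 3
    have h4 := hc 4
    have h5 := hc 5
    have h6 := hc 6
    simp [P, Polynomial.coeff_X, Polynomial.coeff_C] at h0 h1 h2 h3 h4 h5 h6
    simp_all
  obtain ⟨x, hx⟩ := Infinite.exists_notMem_finset (F ∪ P.roots.toFinset)
  simp only [Finset.mem_union, Multiset.mem_toFinset, Polynomial.mem_roots hP, not_or] at hx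
  exact ⟨x, hx.1, by simpa [P, Polynomial.IsRoot] using hx.2⟩

theorem exists_cubic_root {c₀ c₁ c₂ c₃ : ℂ} (h₀ : c₀ ≠ 0) (h : c₁ ≠ 0 ∨ c₂ ≠ 0 ∨ c₃ ≠ 0) :
    ∃ x ≠ 0, c₀ + c₁ * x + c₂ * x ^ 2 + c₃ * x ^ 3 = 0 := by
  open Polynomial in
  let P : ℂ[X] := C c₀ + C c₁ * X + C c₂ * X ^ 2 + C c₃ * X ^ 3
  have hP : P.degree ≠ 0 := by
    intro h0
    have hc : ∀ n, 0 < n → P.coeff n = 0 := fun n hn =>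
      Polynomial.coeff_eq_zero_of_degree_lt (by rw [h0]; exact_mod_cast hn)
    have h1 := hc 1 (by norm_num)
    have h2 := hc 2 (by norm_num)
    have h3 := hc 3 (by norm_num)
    simp [P, Polynomial.coeff_C] at h1 h2 h3
    simp_all
  obtain ⟨x, hx⟩ := IsAlgClosed.exists_root P hP
  have hx' : c₀ + c₁ * x + c₂ * x ^ 2 + c₃ * x ^ 3 = 0 := by simpa [P, Polynomial.IsRoot] using hx
  exact ⟨x, by rintro rfl; simp at hx'; exact h₀ hx', hx'⟩

theorem isSandwichUpper_of_root {P : Matrix (Fin 3) (Fin 3) ℂ} {u v : ℂ}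
    (h02 : (P * upperToep u v) 0 2 ≠ 0) (hG : sandwichForm (P * upperToep u v) = 0) :
    IsSandwichUpper P :=
  ⟨u, v, isLowerSandwich_of_sandwichForm_eq_zero h02 hG⟩

/-! ### Matrices with a nonzero entry at `(0, 0)`. -/

/-- The block matrix `1 ⊕ [a, b; c, d]`. -/
def oneBlock (a b c d : ℂ) : Matrix (Fin 3) (Fin 3) ℂ := !![1, 0, 0; 0, a, b; 0, c, d]

theorem exists_eq_oneBlock {N : Matrix (Fin 3) (Fin 3) ℂ} (h00 : N 0 0 = 1) (h01 : N 0 1 = 0)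
    (h02 : N 0 2 = 0) (h10 : N 1 0 = 0) (h20 : N 2 0 = 0) :
    ∃ a b c d, N = oneBlock a b c d :=
  ⟨N 1 1, N 1 2, N 2 1, N 2 2, by rw [Matrix.eta_fin_three N]; simp [oneBlock, *]⟩

theorem isSandwichUpper_oneBlock {a b c d u v : ℂ} (hv : v ≠ 0)
    (h : -c * v ^ 2 + v * ((u * a + b) * (a - 1) - u * (a - d) + u ^ 2 * c) -
      u * (u * a + b) * (u * a + b - u) = 0) : IsSandwichUpper (oneBlock a b c d) := by
  apply isSandwichUpper_of_root (u := u) (v := v)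
  · simpa [oneBlock, upperToep, Matrix.mul_apply, Fin.sum_univ_three] using hv
  · rw [← h]
    simp [sandwichForm, oneBlock, upperToep, Matrix.mul_apply, Fin.sum_univ_three]
    ring

theorem isSandwichUpper_oneBlock_of_ne_zero (a b : ℂ) {c : ℂ} (d : ℂ) (hc : c ≠ 0) :
    -- The condition is quadratic in `v` with leading coefficient `-c`. Choosing `u` with nonzero
    -- linear coefficient leaves a nonzero root even if the constant term vanishes.
    IsSandwichUpper (oneBlock a b c d) := by
  obtain ⟨u, -, hB⟩ := exists_poly_ne_zero (c₀ := b * (a - 1)) (c₁ := a * (a - 1) - (a - d))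
    (c₂ := c) (c₃ := 0) (c₄ := 0) (c₅ := 0) (c₆ := 0) (by simp [hc]) ∅
  by_cases hC : u * (u * a + b) * (u * a + b - u) = 0
  · refine isSandwichUpper_oneBlock (u := u)
      (v := ((u * a + b) * (a - 1) - u * (a - d) + u ^ 2 * c) / c)
      (div_ne_zero (fun h => hB (by linear_combination h)) hc) ?_
    rw [hC]
    field_simp
    ring
  · obtain ⟨v, hv, h⟩ := exists_cubic_root (c₀ := -(u * (u * a + b) * (u * a + b - u)))
      (c₁ := (u * a + b) * (a - 1) - u * (a - d) + u ^ 2 * c) (c₂ := -c) (c₃ := 0)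
      (neg_ne_zero.2 hC) (by simp [hc])
    exact isSandwichUpper_oneBlock (u := u) hv (by linear_combination h)

theorem isSandwichUpper_oneBlock_diagonal {a d : ℂ}
    (h : (a ≠ 0 ∧ a ≠ 1 ∧ a ^ 2 - 2 * a + d ≠ 0) ∨ a = d) :
    IsSandwichUpper (oneBlock a 0 0 d) := by
  by_cases had : a ^ 2 - 2 * a + d = 0
  · obtain rfl : a = d := h.resolve_left fun h => h.2.2 had
    -- With `b = c = 0` every term of the condition contains `u`.
    refine isSandwichUpper_oneBlock (u := 0) (v := 1) one_ne_zero (by ring)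
  by_cases h01 : a ≠ 0 ∧ a ≠ 1
  · obtain ⟨v, hv⟩ : ∃ v, v * (a ^ 2 - 2 * a + d) = a * (a - 1) := ⟨_, div_mul_cancel₀ _ had⟩
    refine isSandwichUpper_oneBlock (u := 1) (v := v) ?_ (by linear_combination hv)
    rintro rfl
    exact mul_ne_zero h01.1 (sub_ne_zero.2 h01.2) (by rw [← hv, zero_mul])
  · exfalso
    obtain rfl : a = d := h.resolve_left fun h => h01 ⟨h.1, h.2.1⟩
    apply h01
    constructor <;> rintro rfl <;> norm_num at had

theorem isSandwichMul_oneBlock_diagonal (a d : ℂ) : IsSandwichMul (oneBlock a 0 0 d) := by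
  by_cases h : (a ≠ 0 ∧ a ≠ 1 ∧ a ^ 2 - 2 * a + d ≠ 0) ∨ a = d
  · exact (isSandwichUpper_oneBlock_diagonal h).isSandwichMul
  push Not at h
  by_cases h01 : a ≠ 0 ∧ a ≠ 1
  · have h2 := h.1 h01.1 h01.2
    -- These coefficients turn the cubic form into `-(a² - 2a + d)`; those of the other case give
    -- `-4a(a - 1)`.
    apply isSandwichMul_of_mul_circToep (f := 1) (x := 0) (y := 1) (z := 1) (by norm_num)
    apply isLowerSandwich_of_sandwichForm_eq_zero
    · simp [oneBlock, circToep, Matrix.mul_apply, Fin.sum_univ_three]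
    · simp [sandwichForm, oneBlock, circToep, Matrix.mul_apply, Fin.sum_univ_three]
      linear_combination -h2
  · apply isSandwichMul_of_mul_circToep (f := 2) (x := 1) (y := 1) (z := 1) (by norm_num)
    have h01' : a * (a - 1) = 0 := by
      by_contra h'
      exact h01 ⟨left_ne_zero_of_mul h', sub_ne_zero.1 (right_ne_zero_of_mul h')⟩
    apply isLowerSandwich_of_sandwichForm_eq_zero
    · simp [oneBlock, circToep, Matrix.mul_apply, Fin.sum_univ_three]
    · simp [sandwichForm, oneBlock, circToep, Matrix.mul_apply, Fin.sum_univ_three]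
      linear_combination (-4) * h01'

/-- Taking `f = k - x s` makes the `(0, 2)` entry of the product the free parameter `k`, in which
the cubic condition is quadratic. -/
theorem isSandwichMul_diagonal_mul_upperToep_of_root {a d r s x k : ℂ} (hk : k ≠ 0)
    (hdet : x ^ 3 + k - x * s ≠ 0)
    (h : (a - d) * k ^ 2 + k * ((x * r * (a - 1) - s) * (x * (a - d) + r * a) +
      x * r * a * (x * (d - 1) - r)) - x * r * a * (x * r * (a - 1) - s) * (x * r + s) = 0) :
    IsSandwichMul (oneBlock a 0 0 d * upperToep r s) := by
  have hprod : oneBlock a 0 0 d * upperToep r s * circToep (k - x * s) x 1 0 =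
      !![x + r, x * r + s, k; a, a * (x + r), x * r * a; 0, d, x * d] := by
    ext i j
    fin_cases i <;> fin_cases j <;>
      simp [oneBlock, upperToep, circToep, Matrix.mul_apply, Fin.sum_univ_three] <;> ring
  apply isSandwichMul_of_mul_circToep (f := k - x * s) (x := x) (y := 1) (z := 0)
    (fun h => hdet (by linear_combination h))
  rw [hprod]
  apply isLowerSandwich_of_sandwichForm_eq_zero
  · simpa using hk
  · rw [← h]
    simp [sandwichForm]
    ring

theorem isSandwichMul_diagonal_mul_upperToep {a d r s : ℂ} (had : a ≠ d)
    (hrs : r ≠ 0 ∨ s ≠ 0) : IsSandwichMul (oneBlock a 0 0 d * upperToep r s) := by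
  have had' := sub_ne_zero.2 had
  by_cases hr : r = 0
  · subst hr
    refine IsLowerSandwich.isSandwichMul (isLowerSandwich_of_sandwichForm_eq_zero ?_ ?_)
    · simpa [oneBlock, upperToep, Matrix.mul_apply, Fin.sum_univ_three] using hrs
    · simp [sandwichForm, oneBlock, upperToep, Matrix.mul_apply, Fin.sum_univ_three]
  by_cases ha : a = 0
  · subst ha
    obtain ⟨x, hx, -⟩ := exists_poly_ne_zero (c₀ := 1) (c₁ := 0) (c₂ := 0) (c₃ := 0) (c₄ := 0)
      (c₅ := 0) (c₆ := 0) (by simp) {0, -r, -s / r}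
    simp only [Finset.mem_insert, Finset.mem_singleton, not_or] at hx
    have h1 : x * r + s ≠ 0 := fun h => hx.2.2 (by field_simp; linear_combination h)
    have h2 : x + r ≠ 0 := fun h => hx.2.1 (by linear_combination h)
    refine isSandwichMul_diagonal_mul_upperToep_of_root (x := x) (k := x * (x * r + s))
      (mul_ne_zero hx.1 h1) ?_ (by ring)
    have : x ^ 3 + x * (x * r + s) - x * s = x ^ 2 * (x + r) := by ring
    rw [this]
    exact mul_ne_zero (pow_ne_zero 2 hx.1) h2
  by_cases h1s : a = 1 ∧ s = 0
  · obtain ⟨rfl, rfl⟩ := h1s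
    obtain ⟨x, hx, h6⟩ := exists_poly_ne_zero (c₀ := r ^ 2) (c₁ := r * (1 - d)) (c₂ := 1 - d)
      (c₃ := 0) (c₄ := 0) (c₅ := 0) (c₆ := 0) (by simp [had']) {0, -r / (1 - d)}
    simp only [Finset.mem_insert, Finset.mem_singleton, not_or] at hx
    have h1 : (1 - d) * x + r ≠ 0 := fun h => hx.2 (by field_simp; linear_combination h)
    refine isSandwichMul_diagonal_mul_upperToep_of_root (x := x)
      (k := x * r * ((1 - d) * x + r) / (1 - d))
      (div_ne_zero (mul_ne_zero (mul_ne_zero hx.1 hr) h1) had') ?_ (by field_simp; ring)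
    intro h
    field_simp at h
    apply h6
    apply mul_left_cancel₀ hx.1
    linear_combination h
  -- This polynomial is the quadratic evaluated at `k = x s - x³`, where the circulant is singular;
  -- `x` keeps that value from being a root.
  obtain ⟨x, hx, h6⟩ := exists_poly_ne_zero (c₀ := 0)
    (c₁ := s * (-(s * r * a)) + r * a * s ^ 2)
    (c₂ := s * (r ^ 2 * a * (a - 2) - s * (a - d)) + (a - d) * s ^ 2 - r * a * (r * s * (a - 2)))
    (c₃ := s * (r * (a - 1) * (a - d) + r * a * (d - 1)) + s * r * a - r * a * (r ^ 2 * (a - 1)))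
    (c₄ := -(r ^ 2 * a * (a - 2) - s * (a - d)) - 2 * s * (a - d))
    (c₅ := -(r * (a - 1) * (a - d) + r * a * (d - 1))) (c₆ := a - d)
    (by simp [had']) {0, -s / r, s / (r * (a - 1))}
  simp only [Finset.mem_insert, Finset.mem_singleton, not_or] at hx
  have h1 : x * r + s ≠ 0 := fun h => hx.2.1 (by field_simp; linear_combination h)
  have h2 : x * r * (a - 1) - s ≠ 0 := by
    intro h
    by_cases ha1 : a = 1
    · exact h1s ⟨ha1, by rw [ha1] at h; linear_combination -h⟩
    · have := sub_ne_zero.2 ha1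
      exact hx.2.2 (by field_simp; linear_combination h)
  obtain ⟨k, hk, hroot⟩ := exists_cubic_root
    (c₀ := -(x * r * a * (x * r * (a - 1) - s) * (x * r + s)))
    (c₁ := (x * r * (a - 1) - s) * (x * (a - d) + r * a) + x * r * a * (x * (d - 1) - r))
    (c₂ := a - d) (c₃ := 0)
    (neg_ne_zero.2 (mul_ne_zero (mul_ne_zero (mul_ne_zero (mul_ne_zero hx.1 hr) ha) h2) h1))
    (by simp [had'])
  refine isSandwichMul_diagonal_mul_upperToep_of_root (x := x) (k := k) hk ?_
    (by linear_combination hroot)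
  intro h
  obtain rfl : k = x * s - x ^ 3 := by linear_combination h
  exact h6 (by linear_combination hroot)

theorem lowerToep_mul_mul_upperToep (M : Matrix (Fin 3) (Fin 3) ℂ) (p q u v : ℂ) :
    lowerToep p q * M * upperToep u v =
      !![M 0 0, u * M 0 0 + M 0 1, v * M 0 0 + u * M 0 1 + M 0 2;
        p * M 0 0 + M 1 0, p * (u * M 0 0 + M 0 1) + (u * M 1 0 + M 1 1),
        p * (v * M 0 0 + u * M 0 1 + M 0 2) + (v * M 1 0 + u * M 1 1 + M 1 2);
        q * M 0 0 + p * M 1 0 + M 2 0,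
        q * (u * M 0 0 + M 0 1) + p * (u * M 1 0 + M 1 1) + (u * M 2 0 + M 2 1),
        q * (v * M 0 0 + u * M 0 1 + M 0 2) + p * (v * M 1 0 + u * M 1 1 + M 1 2) +
          (v * M 2 0 + u * M 2 1 + M 2 2)] := by
  ext i j
  fin_cases i <;> fin_cases j <;>
    simp only [lowerToep, upperToep, Matrix.mul_apply, Fin.sum_univ_three] <;> simp <;> ring

theorem isFourToeplitz_of_apply_zero_zero_ne_zero {M : Matrix (Fin 3) (Fin 3) ℂ}
    (h00 : M 0 0 ≠ 0) : IsFourToeplitz M := by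
  obtain ⟨c, hc⟩ : ∃ c, c * M 0 0 = 1 := ⟨_, inv_mul_cancel₀ h00⟩
  have hc0 : c ≠ 0 := left_ne_zero_of_mul_eq_one hc
  obtain ⟨p, q, u, v, α, β, γ, δ, hM⟩ : ∃ p q u v α β γ δ,
      c • (lowerToep p q * M * upperToep u v) = oneBlock α β γ δ := by
    obtain ⟨u, hu⟩ : ∃ u, u * M 0 0 + M 0 1 = 0 := ⟨-M 0 1 * c, by linear_combination -M 0 1 * hc⟩
    obtain ⟨v, hv⟩ : ∃ v, v * M 0 0 + u * M 0 1 + M 0 2 = 0 :=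
      ⟨-(u * M 0 1 + M 0 2) * c, by linear_combination -(u * M 0 1 + M 0 2) * hc⟩
    obtain ⟨p, hp⟩ : ∃ p, p * M 0 0 + M 1 0 = 0 := ⟨-M 1 0 * c, by linear_combination -M 1 0 * hc⟩
    obtain ⟨q, hq⟩ : ∃ q, q * M 0 0 + p * M 1 0 + M 2 0 = 0 :=
      ⟨-(p * M 1 0 + M 2 0) * c, by linear_combination -(p * M 1 0 + M 2 0) * hc⟩
    refine ⟨p, q, u, v, ?_⟩
    rw [lowerToep_mul_mul_upperToep, hu, hv, hp, hq]
    apply exists_eq_oneBlock <;> simp [hc]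
  by_cases hγ : γ = 0
  swap
  · exact IsSandwichUpper.isFourToeplitz_of_equiv hc0
      (hM ▸ isSandwichUpper_oneBlock_of_ne_zero α β δ hγ)
  have hMt : c • (lowerToep u v * M.transpose * upperToep p q) = oneBlock α γ β δ := by
    have := congrArg Matrix.transpose hM
    have ho : (oneBlock α β γ δ).transpose = oneBlock α γ β δ := by
      ext i j
      fin_cases i <;> fin_cases j <;> simp [oneBlock]
    rw [ho] at this
    rw [← this, ← lowerToep_transpose p q, ← Matrix.transpose_transpose (lowerToep u v),
      lowerToep_transpose]
    simp [Matrix.mul_assoc]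
  by_cases hβ : β = 0
  swap
  · exact .of_transpose (IsSandwichUpper.isFourToeplitz_of_equiv hc0
      (hMt ▸ isSandwichUpper_oneBlock_of_ne_zero α γ δ hβ))
  subst hγ hβ
  by_cases had : α = δ
  · exact IsSandwichUpper.isFourToeplitz_of_equiv hc0
      (hM ▸ isSandwichUpper_oneBlock_diagonal (Or.inr had))
  have hMU : ∀ {N : Matrix (Fin 3) (Fin 3) ℂ} {p q u v : ℂ},
      c • (lowerToep p q * N * upperToep u v) = oneBlock α 0 0 δ → (u ≠ 0 ∨ v ≠ 0) →
      IsFourToeplitz N := by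
    intro N p q u v h huv
    have h' : c • (lowerToep p q * N) = oneBlock α 0 0 δ * upperToep (-u) (u ^ 2 - v) := by
      rw [← h, Matrix.smul_mul, Matrix.mul_assoc _ (upperToep u v), upperToep_mul_inv, mul_one]
    refine (IsSandwichMul.of_lowerToep_mul hc0
      (h' ▸ isSandwichMul_diagonal_mul_upperToep had ?_)).isFourToeplitz
    by_cases hu : u = 0
    · right
      simpa [hu] using huv
    · exact Or.inl (neg_ne_zero.2 hu)
  by_cases huv : u ≠ 0 ∨ v ≠ 0
  · exact hMU hM huv
  by_cases hpq : p ≠ 0 ∨ q ≠ 0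
  · exact .of_transpose (hMU hMt hpq)
  push Not at huv hpq
  obtain ⟨rfl, rfl⟩ := huv
  rw [upperToep_zero, mul_one] at hM
  exact (IsSandwichMul.of_lowerToep_mul hc0
    (hM ▸ isSandwichMul_oneBlock_diagonal α δ)).isFourToeplitz

/-! ### Matrices with zero `(0, 0)` and nonzero `(0, 1)` entry. -/

/-- The matrix obtained from `1 ⊕ [α, β; γ, δ]` by exchanging the first two columns. -/
def swapBlock (α β γ δ : ℂ) : Matrix (Fin 3) (Fin 3) ℂ := !![0, 1, 0; α, 0, β; γ, 0, δ]

theorem exists_eq_swapBlock {N : Matrix (Fin 3) (Fin 3) ℂ} (h00 : N 0 0 = 0) (h01 : N 0 1 = 1)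
    (h02 : N 0 2 = 0) (h11 : N 1 1 = 0) (h21 : N 2 1 = 0) :
    ∃ α β γ δ, N = swapBlock α β γ δ :=
  ⟨N 1 0, N 1 2, N 2 0, N 2 2, by rw [Matrix.eta_fin_three N]; simp [swapBlock, *]⟩

theorem isSandwichUpper_swapBlock_of_root {α β γ δ u v : ℂ} (hu : u ≠ 0)
    (h : -γ * u ^ 3 + α * (v * α + β) * u ^ 2 + u * (v * γ + δ) -
      (v * α + β) * (v * α + β - 1) = 0) : IsSandwichUpper (swapBlock α β γ δ) := by
  apply isSandwichUpper_of_root (u := u) (v := v)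
  · simpa [swapBlock, upperToep, Matrix.mul_apply, Fin.sum_univ_three] using hu
  · rw [← h]
    simp [sandwichForm, swapBlock, upperToep, Matrix.mul_apply, Fin.sum_univ_three]
    ring

theorem isSandwichUpper_swapBlock {α γ : ℂ} (β δ : ℂ) (h : α ≠ 0 ∨ γ ≠ 0) :
    IsSandwichUpper (swapBlock α β γ δ) := by
  by_cases hα : α = 0
  · subst hα
    have hγ : γ ≠ 0 := by simpa using h
    by_cases hβ : β * (β - 1) = 0
    · obtain ⟨v, hv⟩ : ∃ v, v * γ = γ - δ := ⟨_, div_mul_cancel₀ _ hγ⟩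
      exact isSandwichUpper_swapBlock_of_root (u := 1) (v := v) one_ne_zero
        (by linear_combination hv - hβ)
    · obtain ⟨u, hu, hroot⟩ := exists_cubic_root (c₀ := -(β * (β - 1))) (c₁ := δ) (c₂ := 0)
        (c₃ := -γ) (neg_ne_zero.2 hβ) (by simp [hγ])
      exact isSandwichUpper_swapBlock_of_root (v := 0) hu (by linear_combination hroot)
  -- Setting `w = v α + β` to `2` makes the constant term `-w (w - 1)` nonzero.
  · obtain ⟨v, hv⟩ : ∃ v, v * α = 2 - β := ⟨_, div_mul_cancel₀ _ hα⟩
    obtain ⟨u, hu, hroot⟩ := exists_cubic_root (c₀ := -2) (c₁ := v * γ + δ) (c₂ := α * 2)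
      (c₃ := -γ) (by norm_num) (by simp [hα])
    refine isSandwichUpper_swapBlock_of_root (v := v) hu ?_
    have hw : v * α + β = 2 := by linear_combination hv
    rw [hw]
    linear_combination hroot

theorem isFourToeplitz_of_swapBlock {M : Matrix (Fin 3) (Fin 3) ℂ} {c p q u v β δ : ℂ}
    (hc : c ≠ 0) (hM : c • (lowerToep p q * M * upperToep u v) = swapBlock 0 β 0 δ) :
    IsFourToeplitz M := by
  have h' : c • (lowerToep p q * M) = swapBlock 0 β 0 δ * upperToep (-u) (u ^ 2 - v) := by
    rw [← hM, Matrix.smul_mul, Matrix.mul_assoc _ (upperToep u v), upperToep_mul_inv, mul_one]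
  by_cases hβ : β = 1
  · subst hβ
    have hfac : swapBlock 0 1 0 δ * upperToep (-u) (u ^ 2 - v) =
        toep 0 1 0 0 1 * toep 0 δ 0 1 0 * toep (-u) 1 0 0 0 := by
      ext i j
      fin_cases i <;> fin_cases j <;>
        simp [swapBlock, upperToep, toep, Matrix.mul_apply, Fin.sum_univ_three]
    refine ⟨_, _, _, _, (isToeplitz_lowerToep (-p) (p ^ 2 - q)).smul c⁻¹,
      isToeplitz_toep 0 1 0 0 1, isToeplitz_toep 0 δ 0 1 0, isToeplitz_toep (-u) 1 0 0 0, ?_⟩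
    rw [Matrix.mul_assoc, Matrix.mul_assoc, ← Matrix.mul_assoc (toep 0 1 0 0 1), ← hfac, ← h',
      Matrix.smul_mul, Matrix.mul_smul, ← Matrix.mul_assoc, lowerToep_inv_mul, smul_smul,
      inv_mul_cancel₀ hc, one_smul, one_mul]
  · obtain ⟨y, hy⟩ : ∃ y, y * (β - 1) = δ := ⟨_, div_mul_cancel₀ _ (sub_ne_zero.2 hβ)⟩
    refine (IsSandwichMul.of_lowerToep_mul (p := p) (q := q) hc ?_).isFourToeplitz
    rw [h']
    -- The right factor has zero last row, so the third column of the left one is free; it is chosen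
    -- to kill the cubic form.
    refine ⟨!![1, 0, 1; 0, β, y; 0, δ, 0], toep (-u) 1 0 0 0,
      isLowerSandwich_of_sandwichForm_eq_zero ?_ ?_, isToeplitz_toep _ _ _ _ _, ?_⟩
    · simp
    · simp [sandwichForm]
      linear_combination hy
    · ext i j
      fin_cases i <;> fin_cases j <;>
        simp [swapBlock, upperToep, toep, Matrix.mul_apply, Fin.sum_univ_three]

theorem isFourToeplitz_of_apply_zero_one_ne_zero {M : Matrix (Fin 3) (Fin 3) ℂ}
    (h00 : M 0 0 = 0) (h01 : M 0 1 ≠ 0) : IsFourToeplitz M := by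
  obtain ⟨c, hc⟩ : ∃ c, c * M 0 1 = 1 := ⟨_, inv_mul_cancel₀ h01⟩
  have hc0 : c ≠ 0 := left_ne_zero_of_mul_eq_one hc
  obtain ⟨p, q, u, v, α, β, γ, δ, hM⟩ : ∃ p q u v α β γ δ,
      c • (lowerToep p q * M * upperToep u v) = swapBlock α β γ δ := by
    obtain ⟨u, hu⟩ : ∃ u, u * M 0 1 + M 0 2 = 0 := ⟨-M 0 2 * c, by linear_combination -M 0 2 * hc⟩
    obtain ⟨p, hp⟩ : ∃ p, p * M 0 1 + (u * M 1 0 + M 1 1) = 0 :=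
      ⟨-(u * M 1 0 + M 1 1) * c, by linear_combination -(u * M 1 0 + M 1 1) * hc⟩
    obtain ⟨q, hq⟩ : ∃ q, q * M 0 1 + p * (u * M 1 0 + M 1 1) + (u * M 2 0 + M 2 1) = 0 :=
      ⟨-(p * (u * M 1 0 + M 1 1) + (u * M 2 0 + M 2 1)) * c,
        by linear_combination -(p * (u * M 1 0 + M 1 1) + (u * M 2 0 + M 2 1)) * hc⟩
    refine ⟨p, q, u, 0, ?_⟩
    rw [lowerToep_mul_mul_upperToep, h00]
    simp only [mul_zero, zero_add, zero_mul]
    rw [hu, hp, hq]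
    apply exists_eq_swapBlock <;> simp [hc]
  by_cases h : α ≠ 0 ∨ γ ≠ 0
  · exact IsSandwichUpper.isFourToeplitz_of_equiv hc0 (hM ▸ isSandwichUpper_swapBlock β δ h)
  · push Not at h
    obtain ⟨rfl, rfl⟩ := h
    exact isFourToeplitz_of_swapBlock hc0 hM

/-! ### Rank one matrices and the remaining cases. -/

/-- The outer factors have row sums `x` and column sums `y` respectively. -/
theorem vecMulVec_eq_toep_mul (x y : Fin 3 → ℂ) :
    Matrix.vecMulVec x y =
      toep (x 0 - x 1) 0 (x 1) 0 (x 2 - x 1) * toep 1 1 1 1 1 *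
        toep (y 2 - y 1) 0 (y 1) 0 (y 0 - y 1) := by
  ext i j
  fin_cases i <;> fin_cases j <;>
    simp [toep, Matrix.vecMulVec_apply, Matrix.mul_apply, Fin.sum_univ_three] <;> ring

theorem isFourToeplitz_of_apply_zero_two_ne_zero {M : Matrix (Fin 3) (Fin 3) ℂ}
    (h01 : M 0 1 = 0) (h02 : M 0 2 ≠ 0) (h10 : M 1 0 = 0) (h12 : M 1 2 = 0) (h21 : M 2 1 = 0) :
    IsFourToeplitz M :=
  (isLowerSandwich_of_sandwichForm_eq_zero h02
    (by simp [sandwichForm, h01, h10, h12, h21])).isSandwichMul.isFourToeplitz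

theorem isFourToeplitz (M : Matrix (Fin 3) (Fin 3) ℂ) : IsFourToeplitz M := by
  by_cases h00 : M 0 0 = 0
  swap
  · exact isFourToeplitz_of_apply_zero_zero_ne_zero h00
  by_cases h22 : M 2 2 = 0
  swap
  · exact .of_flip (isFourToeplitz_of_apply_zero_zero_ne_zero h22)
  by_cases h01 : M 0 1 = 0
  swap
  · exact isFourToeplitz_of_apply_zero_one_ne_zero h00 h01
  by_cases h10 : M 1 0 = 0
  swap
  · exact .of_transpose (isFourToeplitz_of_apply_zero_one_ne_zero h00 h10)
  by_cases h21 : M 2 1 = 0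
  swap
  · exact .of_flip (isFourToeplitz_of_apply_zero_one_ne_zero h22 h21)
  by_cases h12 : M 1 2 = 0
  swap
  · exact .of_transpose (.of_flip (isFourToeplitz_of_apply_zero_one_ne_zero h22 h12))
  by_cases h02 : M 0 2 = 0
  swap
  · exact isFourToeplitz_of_apply_zero_two_ne_zero h01 h02 h10 h12 h21
  by_cases h20 : M 2 0 = 0
  swap
  · exact .of_transpose (isFourToeplitz_of_apply_zero_two_ne_zero h10 h20 h01 h21 h12)
  refine ⟨_, _, _, _, isToeplitz_toep (-1) 0 1 0 (-1), isToeplitz_toep 1 1 1 1 1,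
    isToeplitz_toep (-M 1 1) 0 (M 1 1) 0 (-M 1 1), isToeplitz_upperToep 0 0, ?_⟩
  rw [upperToep_zero, mul_one]
  have := vecMulVec_eq_toep_mul ![0, 1, 0] ![0, M 1 1, 0]
  simp only [Matrix.cons_val, zero_sub] at this
  rw [← this]
  ext i j
  fin_cases i <;> fin_cases j <;> simp [Matrix.vecMulVec_apply, *]

/-! ### Toeplitz numbers and the lower bound. -/

theorem HasToeplitzDecomposition.toeplitzNumber_le {n s : ℕ} {M : Matrix (Fin n) (Fin n) ℂ}
    (hs : 1 ≤ s) (h : HasToeplitzDecomposition M s) : toeplitzNumber M ≤ s :=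
  iInf₂_le s ⟨hs, h⟩

theorem toeplitzNumber_le_three {n : ℕ} {M A B C : Matrix (Fin n) (Fin n) ℂ} (hA : IsToeplitz A)
    (hB : IsToeplitz B) (hC : IsToeplitz C) (h : M = A * B * C) : toeplitzNumber M ≤ 3 := by
  refine HasToeplitzDecomposition.toeplitzNumber_le (s := 3) (by norm_num) ⟨![A, B, C], ?_, ?_⟩
  · intro k
    fin_cases k <;> assumption
  · simp [List.ofFn_succ, h, Matrix.mul_assoc]

theorem IsFourToeplitz.toeplitzNumber_le {M : Matrix (Fin 3) (Fin 3) ℂ} (h : IsFourToeplitz M) :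
    toeplitzNumber M ≤ 4 := by
  obtain ⟨A, B, C, D, hA, hB, hC, hD, h⟩ := h
  refine HasToeplitzDecomposition.toeplitzNumber_le (s := 4) (by norm_num) ⟨![A, B, C, D], ?_, ?_⟩
  · intro k
    fin_cases k <;> assumption
  · simp [List.ofFn_succ, h, Matrix.mul_assoc]

theorem toeplitzNumber_le_three_of_rank_eq_one {M : Matrix (Fin 3) (Fin 3) ℂ} (h : M.rank = 1) :
    toeplitzNumber M ≤ 3 := by
  obtain ⟨x, y, rfl⟩ : ∃ x y, M = Matrix.vecMulVec x y := by
    obtain ⟨x, -, hx⟩ := finrank_eq_one_iff'.1 h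
    choose y hy using fun j => hx ⟨M.mulVecLin (Pi.single j 1), LinearMap.mem_range_self _ _⟩
    refine ⟨x, y, ?_⟩
    ext i j
    have := congrFun (congrArg Subtype.val (hy j)) i
    simp at this
    rw [Matrix.vecMulVec_apply, mul_comm, this]
  exact toeplitzNumber_le_three (isToeplitz_toep _ _ _ _ _) (isToeplitz_toep _ _ _ _ _)
    (isToeplitz_toep _ _ _ _ _) (vecMulVec_eq_toep_mul x y)

theorem toeplitzNumber_diagonal_le :
    toeplitzNumber (Matrix.diagonal ![(1 : ℂ), 2, 3]) ≤ 3 := by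
  -- Zero first off-diagonals decouple index `1` from `{0, 2}`: the centre gives `1 · (-1) · (-2) =
  -- 2`, the corner blocks multiply to `diag(1, 3)`.
  refine toeplitzNumber_le_three (isToeplitz_toep 0 0 1 0 2)
    (isToeplitz_toep (-1) 0 (-1) 0 (1 / 2)) (isToeplitz_toep 2 0 (-2) 0 1) ?_
  ext i j
  fin_cases i <;> fin_cases j <;>
    simp [toep, Matrix.mul_apply, Fin.sum_univ_three] <;> norm_num

theorem diagonal_ne_mul {S T : Matrix (Fin 3) (Fin 3) ℂ} (hS : IsToeplitz S)
    (hT : IsToeplitz T) : Matrix.diagonal ![(1 : ℂ), 2, 3] ≠ S * T := by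
  intro h
  have hflip : T * S = Matrix.diagonal ![(3 : ℂ), 2, 1] := by
    rw [hS.eq_toep, hT.eq_toep] at h ⊢
    ext i j
    have := congrFun₂ h j.rev i.rev
    fin_cases i <;> fin_cases j <;>
      simp [toep, Matrix.mul_apply, Fin.sum_univ_three, Matrix.diagonal, Fin.rev] at this ⊢ <;>
      linear_combination -this
  have hcomm : S * Matrix.diagonal ![(3 : ℂ), 2, 1] = Matrix.diagonal ![(1 : ℂ), 2, 3] * S := by
    rw [← hflip, h, Matrix.mul_assoc]
  have h00 := congrFun₂ hcomm 0 0
  have h10 := congrFun₂ hcomm 1 0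
  have h12 := congrFun₂ hcomm 1 2
  have h11 := congrFun₂ h 1 1
  simp only [Matrix.mul_diagonal, Matrix.diagonal_mul, Matrix.cons_val] at h00 h10 h12
  have hs00 : S 1 1 = 0 := by
    rw [← hS 0 0 1 1 rfl rfl]
    linear_combination h00 / 2
  have hs10 : S 1 0 = 0 := by linear_combination h10
  have hs12 : S 1 2 = 0 := by linear_combination -h12
  simp [Matrix.mul_apply, Fin.sum_univ_three, hs00, hs10, hs12] at h11

theorem three_le_toeplitzNumber_diagonal :
    3 ≤ toeplitzNumber (Matrix.diagonal ![(1 : ℂ), 2, 3]) := by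
  refine le_iInf₂ fun s hs => ?_
  obtain ⟨hs, T, hT, hprod⟩ := hs
  by_contra! hlt
  have hlt : s < 3 := by exact_mod_cast hlt
  interval_cases s
  -- A single factor is completed by the identity, itself Toeplitz.
  · refine diagonal_ne_mul (hT 0) (upperToep_zero ▸ isToeplitz_upperToep 0 0) ?_
    simpa [List.ofFn_succ] using hprod
  · refine diagonal_ne_mul (hT 0) (hT 1) ?_
    simpa [List.ofFn_succ] using hprod

theorem mainTheorem2 :
    (3 ≤ maxToeplitzNumber 3 ∧ maxToeplitzNumber 3 ≤ 4) ∧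
    toeplitzNumber (Matrix.diagonal ![(1 : ℂ), 2, 3]) = 3 ∧
    (∀ M : Matrix (Fin 3) (Fin 3) ℂ, M.rank = 1 → toeplitzNumber M ≤ 3) ∧
    (∀ M : Matrix (Fin 3) (Fin 3) ℂ, M.rank = 2 → toeplitzNumber M ≤ 4) ∧
    (∀ M : Matrix (Fin 3) (Fin 3) ℂ, IsUnit M → toeplitzNumber M ≤ 4) :=
  ⟨⟨three_le_toeplitzNumber_diagonal.trans (le_iSup toeplitzNumber _),
    iSup_le fun M => (isFourToeplitz M).toeplitzNumber_le⟩,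
    toeplitzNumber_diagonal_le.antisymm three_le_toeplitzNumber_diagonal,
    fun _ h => toeplitzNumber_le_three_of_rank_eq_one h,
    fun M _ => (isFourToeplitz M).toeplitzNumber_le,
    fun M _ => (isFourToeplitz M).toeplitzNumber_le⟩
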